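/- For positive integers $m,n$ let $M_n(\mathbb C)$ be the $n\times n$ complex matrices with the Hilbert–Schmidt inner product $\langle A,B\rangle=\operatorname{tr}[A^*B]$, let $M_n^{++}(\mathbb C)$ be the set of positive definite ones, and for a linear map $\Phi:M_m(\mathbb C)\to M_n(\mathbb C)$ let $\Phi^\dagger:M_n(\mathbb C)\to M_m(\mathbb C)$ be its adjoint. The map $\Phi$ is a Schwarz map if $\Phi(K^*K)\ge\Phi(K)^*\Phi(K)$ for all $K\in M_m(\mathbb C)$, and it is semiunital if $\Phi^\dagger(\mathbf 1)=\frac nm\mathbf 1$. Theorem 4.3. (a) For all $s,t>0$ with $s+t\le 1$, all positive integers $m,n$, all $X,Y\in M_n^{++}(\mathbb C)$, all $K\in M_n(\mathbb C)$, and all semiunital Schwarz maps $\Phi:M_m(\mathbb C)\to M_n(\mathbb C)$ such that $\Phi^\dagger(\mathbf 1)\in M_m^{++}(\mathbb C)$, $$\operatorname{tr}\big[\Phi^\dagger(K^*)\,\Phi^\dagger(Y)^{-s}\,\Phi^\dagger(K)\,\Phi^\dagger(X)^{-t}\big]\;\le\;\Big(\frac nm\Big)^{1-(s+t)}\operatorname{tr}\big[K^*Y^{-s}KX^{-t}\big].$$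 (b) (Lieb convexity theorem) For all $s,t\ge 0$ with $s+t\le 1$ and all positive integers $n$, the function $$(X,Y,K)\mapsto \operatorname{tr}\big[K^*Y^{-s}KX^{-t}\big]$$ is jointly convex on $M_n^{++}(\mathbb C)\times M_n^{++}(\mathbb C)\times M_n(\mathbb C)$. -/

import Mathlib

open scoped ComplexOrder MatrixOrder

/-- The adjoint of a linear map between complex matrix algebras with respect to the
Hilbert–Schmidt inner products `⟪A, B⟫ = tr (Aᴴ * B)`.  Its `(i, j)` entry is the
inner product with the image of the matrix unit `E i j`; the defining identity and uniqueness are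
proved below. -/
def hsAdjoint {m n : ℕ} (Φ : Matrix (Fin m) (Fin m) ℂ →ₗ[ℂ] Matrix (Fin n) (Fin n) ℂ) :
    Matrix (Fin n) (Fin n) ℂ →ₗ[ℂ] Matrix (Fin m) (Fin m) ℂ where
  toFun A := Matrix.of fun i j => ((Φ (Matrix.single i j 1)).conjTranspose * A).trace
  map_add' A B := by
    ext i j
    simp [Matrix.mul_add]
  map_smul' c A := by
    ext i j
    simp

/-- The defining identity `⟪Φ B, A⟫ = ⟪B, Φ† A⟫`. -/
theorem trace_conjTranspose_mul_hsAdjoint {m n : ℕ}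
    (Φ : Matrix (Fin m) (Fin m) ℂ →ₗ[ℂ] Matrix (Fin n) (Fin n) ℂ)
    (B : Matrix (Fin m) (Fin m) ℂ) (A : Matrix (Fin n) (Fin n) ℂ) :
    ((Φ B).conjTranspose * A).trace = (B.conjTranspose * hsAdjoint Φ A).trace := by
  have hB : Φ B = ∑ i, ∑ j, B i j • Φ (Matrix.single i j 1) := by
    conv_lhs => rw [Matrix.matrix_eq_sum_single B]
    simp only [map_sum, ← map_smul, Matrix.smul_single, smul_eq_mul, mul_one]
  rw [hB]
  simp only [Matrix.conjTranspose_sum, Matrix.conjTranspose_smul, Finset.sum_mul,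
    Matrix.trace_sum, Matrix.smul_mul, Matrix.trace_smul, smul_eq_mul]
  rw [Finset.sum_comm]
  simp [Matrix.trace, Matrix.mul_apply, hsAdjoint]

/-- The defining identity determines the adjoint. -/
theorem eq_hsAdjoint {m n : ℕ}
    (Φ : Matrix (Fin m) (Fin m) ℂ →ₗ[ℂ] Matrix (Fin n) (Fin n) ℂ)
    (Ψ : Matrix (Fin n) (Fin n) ℂ →ₗ[ℂ] Matrix (Fin m) (Fin m) ℂ)
    (h : ∀ B A, ((Φ B).conjTranspose * A).trace = (B.conjTranspose * Ψ A).trace) :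
    Ψ = hsAdjoint Φ := by
  ext A i j
  simp [hsAdjoint, h, Matrix.trace_single_mul]

/-- A Schwarz map: `Φ (Kᴴ K) ≥ (Φ K)ᴴ (Φ K)` in the Loewner order, for every matrix `K`. -/
def IsSchwarzMap {m n : ℕ}
    (Φ : Matrix (Fin m) (Fin m) ℂ →ₗ[ℂ] Matrix (Fin n) (Fin n) ℂ) : Prop :=
  ∀ K : Matrix (Fin m) (Fin m) ℂ,
    (Φ (K.conjTranspose * K) - (Φ K).conjTranspose * Φ K).PosSemidef

/-- A semiunital map `Φ : M_m(ℂ) → M_n(ℂ)`: `Φ† 1 = (n / m) 1`. -/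
def IsSemiunital {m n : ℕ}
    (Φ : Matrix (Fin m) (Fin m) ℂ →ₗ[ℂ] Matrix (Fin n) (Fin n) ℂ) : Prop :=
  hsAdjoint Φ 1 = ((n : ℂ) / (m : ℂ)) • (1 : Matrix (Fin m) (Fin m) ℂ)

/-!
For positive definite `X`, `Y` the commuting operators `L_Y : K ↦ Y * K` and `R_X : K ↦ K * X` are
positive, and `tr (Kᴴ Y⁻ˢ K X⁻ᵗ) = ⟪K, L_Y⁻ˢ R_X⁻ᵗ K⟫`. For `α, β, γ > 0`, Legendre duality gives
`⟪K, (α L_Y + β R_X + γ)⁻¹ K⟫ = max_Z (2 Re ⟪K, Z⟫ - ⟪Z, (α L_Y + β R_X + γ) Z⟫)`.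
The form in `Z` is linear in `(X, Y)`, and the Schwarz inequality for `Φ` compares its value at
`Φ Z` with the value for `(Φ† X, Φ† Y)` at `Z`; maximizing compares the resolvent forms. For
`s + t + r = 1`, the monomial `y⁻ˢ x⁻ᵗ c⁻ʳ` is a positive mixture of the resolvents
`(α y + β x + γ c)⁻¹` (two successive Beta integrals), so the comparison passes to the traces; the
number `c` is an upper bound for `Φ† 1` and contributes the factor `(n / m) ^ r`. Replacing the
single map `Φ` by two copies of the identity with weights `a + b = 1` gives joint convexity.
-/


section GeometricMean

open MeasureTheory Set

theorem integrableOn_rpow_mul_one_add_rpow {p q : ℝ} (hp : 0 < p) (hq : 0 < q) :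
    IntegrableOn (fun u : ℝ ↦ u ^ (p - 1) * (1 + u) ^ (-(p + q))) (Ioi 0) := by
  have hmeas : Measurable (fun u : ℝ ↦ u ^ (p - 1) * (1 + u) ^ (-(p + q))) := by fun_prop
  have hnorm : ∀ u : ℝ, 0 < u → ‖u ^ (p - 1) * (1 + u) ^ (-(p + q))‖ =
      u ^ (p - 1) * (1 + u) ^ (-(p + q)) := fun u hu ↦ Real.norm_of_nonneg (by positivity)
  rw [← Ioc_union_Ioi_eq_Ioi zero_le_one]
  refine IntegrableOn.union ?near_zero ?near_infinity
  case near_zero =>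
    have hdom : IntegrableOn (fun u : ℝ ↦ u ^ (p - 1)) (Ioc 0 1) :=
      (intervalIntegrable_iff_integrableOn_Ioc_of_le zero_le_one).1
        (intervalIntegral.intervalIntegrable_rpow' (by linarith))
    refine hdom.mono' hmeas.aestronglyMeasurable
      (ae_restrict_of_forall_mem measurableSet_Ioc fun u hu ↦ ?_)
    have hle : (1 + u) ^ (-(p + q)) ≤ 1 :=
      Real.rpow_le_one_of_one_le_of_nonpos (by linarith [hu.1]) (by linarith)
    rw [hnorm u hu.1]
    exact mul_le_of_le_one_right (Real.rpow_nonneg hu.1.le _) hle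
  case near_infinity =>
    have hdom : IntegrableOn (fun u : ℝ ↦ u ^ (-1 - q)) (Ioi 1) :=
      integrableOn_Ioi_rpow_of_lt (by linarith) one_pos
    refine hdom.mono' hmeas.aestronglyMeasurable
      (ae_restrict_of_forall_mem measurableSet_Ioi fun u (hu : 1 < u) ↦ ?_)
    have hu₀ : 0 < u := one_pos.trans hu
    rw [hnorm u hu₀]
    calc u ^ (p - 1) * (1 + u) ^ (-(p + q)) ≤ u ^ (p - 1) * u ^ (-(p + q)) := by
          exact mul_le_mul_of_nonneg_left
            (Real.rpow_le_rpow_of_nonpos hu₀ (by linarith) (by linarith))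
            (Real.rpow_nonneg hu₀.le _)
      _ = u ^ (-1 - q) := by
          rw [← Real.rpow_add hu₀]
          ring_nf

theorem integral_rpow_mul_one_add_rpow_pos {p q : ℝ} (hp : 0 < p) (hq : 0 < q) :
    0 < ∫ u in Ioi (0 : ℝ), u ^ (p - 1) * (1 + u) ^ (-(p + q)) := by
  have hpos : ∀ u ∈ Ioi (0 : ℝ), 0 < u ^ (p - 1) * (1 + u) ^ (-(p + q)) := fun u hu ↦
    mul_pos (Real.rpow_pos_of_pos hu _) (Real.rpow_pos_of_pos (add_pos one_pos hu) _)
  rw [setIntegral_pos_iff_support_of_nonneg_ae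
    (ae_restrict_of_forall_mem measurableSet_Ioi fun u hu ↦ (hpos u hu).le)
    (integrableOn_rpow_mul_one_add_rpow hp hq),
    inter_eq_right.2 fun u hu ↦ Function.mem_support.2 (hpos u hu).ne']
  simp only [Real.volume_Ioi, ENNReal.zero_lt_top]

theorem rpow_mul_add_mul_rpow {p q a b u : ℝ} (ha : 0 < a) (hb : 0 < b) (hu : 0 < u) :
    u ^ (p - 1) * (a + u * b) ^ (-(p + q)) = a ^ (-(p + q)) * (b / a) ^ (1 - p) *
      ((b / a * u) ^ (p - 1) * (1 + b / a * u) ^ (-(p + q))) := by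
  have hba : 0 < b / a := div_pos hb ha
  have hfactor : a + u * b = a * (1 + b / a * u) := by field_simp
  have hcancel : (b / a) ^ (1 - p) * (b / a) ^ (p - 1) = 1 := by
    rw [← Real.rpow_add hba, sub_add_sub_cancel', sub_self, Real.rpow_zero]
  rw [hfactor, Real.mul_rpow ha.le (by positivity), Real.mul_rpow hba.le hu.le]
  linear_combination -(a ^ (-(p + q)) * u ^ (p - 1) * (1 + b / a * u) ^ (-(p + q))) * hcancel

theorem integrableOn_rpow_mul_add_mul_rpow {p q a b : ℝ} (hp : 0 < p) (hq : 0 < q)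
    (ha : 0 < a) (hb : 0 < b) :
    IntegrableOn (fun u : ℝ ↦ u ^ (p - 1) * (a + u * b) ^ (-(p + q))) (Ioi 0) := by
  have hscaled := (integrableOn_Ioi_comp_mul_left_iff
    (fun u : ℝ ↦ u ^ (p - 1) * (1 + u) ^ (-(p + q))) 0 (div_pos hb ha)).2
    (by simpa only [mul_zero] using integrableOn_rpow_mul_one_add_rpow hp hq)
  exact IntegrableOn.congr_fun (hscaled.const_mul (a ^ (-(p + q)) * (b / a) ^ (1 - p)))
    (fun u hu ↦ (rpow_mul_add_mul_rpow ha hb hu).symm) measurableSet_Ioi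

theorem integral_rpow_mul_add_mul_rpow {p q a b : ℝ} (ha : 0 < a) (hb : 0 < b) :
    ∫ u in Ioi (0 : ℝ), u ^ (p - 1) * (a + u * b) ^ (-(p + q)) =
      a ^ (-q) * b ^ (-p) * ∫ u in Ioi (0 : ℝ), u ^ (p - 1) * (1 + u) ^ (-(p + q)) := by
  have hba : 0 < b / a := div_pos hb ha
  have hconst : a ^ (-(p + q)) * (b / a) ^ (1 - p) * (b / a)⁻¹ = a ^ (-q) * b ^ (-p) := by
    rw [mul_assoc, ← Real.rpow_neg_one (b / a), ← Real.rpow_add hba,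
      show 1 - p + -1 = -p by ring, Real.div_rpow hb.le ha.le,
      show -(p + q) = -q + -p by ring, Real.rpow_add ha]
    field_simp
  rw [setIntegral_congr_fun measurableSet_Ioi fun u hu ↦ rpow_mul_add_mul_rpow ha hb hu,
    integral_const_mul,
    integral_comp_mul_left_Ioi (fun u : ℝ ↦ u ^ (p - 1) * (1 + u) ^ (-(p + q))) 0 hba, mul_zero,
    smul_eq_mul, ← mul_assoc, hconst]

variable {ι : Type*} [Fintype ι] {w a b c : ι → ℝ}

theorem sum_mul_rpow_mul_rpow_nonneg {p q : ℝ} (hp : 0 < p) (hq : 0 < q)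
    (ha : ∀ i, 0 < a i) (hb : ∀ i, 0 < b i)
    (h : ∀ u : ℝ, 0 < u → 0 ≤ ∑ i, w i * (a i + u * b i) ^ (-(p + q))) :
    0 ≤ ∑ i, w i * (a i ^ (-q) * b i ^ (-p)) := by
  have hint : 0 ≤ ∫ u in Ioi (0 : ℝ),
      ∑ i, w i * (u ^ (p - 1) * (a i + u * b i) ^ (-(p + q))) := by
    refine setIntegral_nonneg measurableSet_Ioi fun u (hu : 0 < u) ↦ ?_
    simpa only [Finset.mul_sum, mul_left_comm] using
      mul_nonneg (Real.rpow_nonneg hu.le (p - 1)) (h u hu)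
  rw [integral_finsetSum _ fun i _ ↦
    (integrableOn_rpow_mul_add_mul_rpow hp hq (ha i) (hb i)).const_mul (w i)] at hint
  simp only [integral_const_mul, integral_rpow_mul_add_mul_rpow (ha _) (hb _)] at hint
  simp only [← mul_assoc, ← Finset.sum_mul] at hint ⊢
  exact nonneg_of_mul_nonneg_left hint (integral_rpow_mul_one_add_rpow_pos hp hq)

theorem sum_mul_geometricMean_nonneg_of_pos
    (ha : ∀ i, 0 < a i) (hb : ∀ i, 0 < b i) (hc : ∀ i, 0 < c i)
    (h : ∀ α β γ : ℝ, 0 < α → 0 < β → 0 < γ →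
      0 ≤ ∑ i, w i * (α * a i + β * b i + γ * c i)⁻¹)
    {s t r : ℝ} (hs : 0 < s) (ht : 0 < t) (hr : 0 < r) (hsum : s + t + r = 1) :
    0 ≤ ∑ i, w i * (a i ^ (-s) * b i ^ (-t) * c i ^ (-r)) := by
  have hpencil : ∀ u : ℝ, 0 < u → ∀ v : ℝ, 0 < v →
      0 ≤ ∑ i, w i * (b i + u * c i + v * a i) ^ (-(s + (t + r))) := fun u hu v hv ↦ by
    simpa only [← add_assoc, hsum, Real.rpow_neg_one, one_mul, add_comm, add_left_comm] using
      h v 1 u hv one_pos hu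
  have hmean : ∀ u : ℝ, 0 < u →
      0 ≤ ∑ i, w i * a i ^ (-s) * (b i + u * c i) ^ (-(r + t)) := fun u hu ↦ by
    simpa only [mul_assoc, mul_comm, mul_left_comm, add_comm t r] using
      sum_mul_rpow_mul_rpow_nonneg hs (add_pos ht hr)
        (fun i ↦ add_pos (hb i) (mul_pos hu (hc i))) ha (hpencil u hu)
  simpa only [mul_assoc] using sum_mul_rpow_mul_rpow_nonneg hr ht hb hc hmean

theorem sum_mul_geometricMean_nonneg
    (ha : ∀ i, 0 < a i) (hb : ∀ i, 0 < b i) (hc : ∀ i, 0 < c i)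
    (h : ∀ α β γ : ℝ, 0 < α → 0 < β → 0 < γ →
      0 ≤ ∑ i, w i * (α * a i + β * b i + γ * c i)⁻¹)
    {s t r : ℝ} (hs : 0 ≤ s) (ht : 0 ≤ t) (hr : 0 ≤ r) (hsum : s + t + r = 1) :
    0 ≤ ∑ i, w i * (a i ^ (-s) * b i ^ (-t) * c i ^ (-r)) := by
  -- Move `(s, t, r)` into the open simplex along the segment to the barycentre.
  let e (x ε : ℝ) : ℝ := (1 - ε) * x + ε / 3
  have hcont : Continuous fun ε : ℝ ↦
      ∑ i, w i * (a i ^ (-e s ε) * b i ^ (-e t ε) * c i ^ (-e r ε)) := by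
    have hpow : ∀ {y x : ℝ}, 0 < y → Continuous fun ε : ℝ ↦ y ^ (-e x ε) := fun hy ↦
      continuous_const.rpow (by fun_prop) fun _ ↦ Or.inl hy.ne'
    exact continuous_finsetSum _ fun i _ ↦
      continuous_const.mul (((hpow (ha i)).mul (hpow (hb i))).mul (hpow (hc i)))
  have hlim := (hcont.tendsto 0).mono_left (nhdsWithin_le_nhds (s := Ioi 0))
  simp only [e, sub_zero, one_mul, zero_div, add_zero] at hlim
  refine ge_of_tendsto hlim ?_
  filter_upwards [Ioo_mem_nhdsGT zero_lt_one] with ε hε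
  have he : ∀ {x : ℝ}, 0 ≤ x → 0 < e x ε := fun hx ↦
    add_pos_of_nonneg_of_pos (mul_nonneg (by linarith [hε.2]) hx) (by linarith [hε.1])
  exact sum_mul_geometricMean_nonneg_of_pos ha hb hc h (he hs) (he ht) (he hr)
    (by linear_combination (1 - ε) * hsum)

theorem sum_mul_geometricMean_le_sum {ι' : Type*} [Fintype ι'] {w' a' b' c' : ι' → ℝ}
    (ha : ∀ i, 0 < a i) (hb : ∀ i, 0 < b i) (hc : ∀ i, 0 < c i)
    (ha' : ∀ i, 0 < a' i) (hb' : ∀ i, 0 < b' i) (hc' : ∀ i, 0 < c' i)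
    (h : ∀ α β γ : ℝ, 0 < α → 0 < β → 0 < γ →
      ∑ i, w i * (α * a i + β * b i + γ * c i)⁻¹ ≤
        ∑ i, w' i * (α * a' i + β * b' i + γ * c' i)⁻¹)
    {s t r : ℝ} (hs : 0 ≤ s) (ht : 0 ≤ t) (hr : 0 ≤ r) (hsum : s + t + r = 1) :
    ∑ i, w i * (a i ^ (-s) * b i ^ (-t) * c i ^ (-r)) ≤
      ∑ i, w' i * (a' i ^ (-s) * b' i ^ (-t) * c' i ^ (-r)) := by
  have hmean := sum_mul_geometricMean_nonneg (w := Sum.elim w' (-w)) (a := Sum.elim a' a)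
    (b := Sum.elim b' b) (c := Sum.elim c' c) (Sum.forall.2 ⟨ha', ha⟩) (Sum.forall.2 ⟨hb', hb⟩)
    (Sum.forall.2 ⟨hc', hc⟩)
    (fun α β γ hα hβ hγ ↦ by
      simpa [← sub_eq_add_neg] using h α β γ hα hβ hγ) hs ht hr hsum
  simpa [← sub_eq_add_neg] using hmean

end GeometricMean

section SpectralForm

open Matrix

variable {m n : Type*} [Fintype m] [DecidableEq m] [Fintype n] [DecidableEq n]
  {X : Matrix n n ℂ} {Y : Matrix m m ℂ}

/-- The matrix of `K` with respect to eigenbases of the Hermitian matrices `Y` (rows) and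
`X` (columns); its matrix units diagonalize `L_Y : K ↦ Y * K` and `R_X : K ↦ K * X`
simultaneously. -/
noncomputable def eigenCoeff (hX : X.IsHermitian) (hY : Y.IsHermitian) (K : Matrix m n ℂ) :
    Matrix m n ℂ :=
  (hY.eigenvectorUnitary : Matrix m m ℂ)ᴴ * K * (hX.eigenvectorUnitary : Matrix n n ℂ)

/-- The quadratic form `K ↦ ⟪K, F(L_Y, R_X) K⟫` of the joint functional calculus of the commuting
left multiplication `L_Y` and right multiplication `R_X`. -/
noncomputable def spectralForm (hX : X.IsHermitian) (hY : Y.IsHermitian) (F : ℝ → ℝ → ℝ)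
    (K : Matrix m n ℂ) : ℝ :=
  ∑ p : m × n, ‖eigenCoeff hX hY K p.1 p.2‖ ^ 2 * F (hY.eigenvalues p.1) (hX.eigenvalues p.2)

theorem eigenCoeff_surjective (hX : X.IsHermitian) (hY : Y.IsHermitian) :
    Function.Surjective (eigenCoeff (m := m) (n := n) hX hY) := fun C ↦ by
  have hU : (hY.eigenvectorUnitary : Matrix m m ℂ)ᴴ * hY.eigenvectorUnitary = 1 :=
    Unitary.coe_star_mul_self _
  have hV : (hX.eigenvectorUnitary : Matrix n n ℂ)ᴴ * hX.eigenvectorUnitary = 1 :=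
    Unitary.coe_star_mul_self _
  refine ⟨(hY.eigenvectorUnitary : Matrix m m ℂ) * C * (hX.eigenvectorUnitary : Matrix n n ℂ)ᴴ, ?_⟩
  rw [eigenCoeff, Matrix.mul_assoc _ C, ← Matrix.mul_assoc, hU, Matrix.one_mul, Matrix.mul_assoc,
    hV, Matrix.mul_one]

theorem trace_conjTranspose_mul_cfc_mul_cfc (hX : X.IsHermitian) (hY : Y.IsHermitian)
    (f g : ℝ → ℝ) (K Z : Matrix m n ℂ) :
    (Kᴴ * cfc f Y * Z * cfc g X).trace = ∑ p : m × n,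
      ((f (hY.eigenvalues p.1) * g (hX.eigenvalues p.2) : ℝ) : ℂ) *
        (star (eigenCoeff hX hY K p.1 p.2) * eigenCoeff hX hY Z p.1 p.2) := by
  have hdiag : (Kᴴ * cfc f Y * Z * cfc g X).trace =
      ((eigenCoeff hX hY K)ᴴ * diagonal (fun i ↦ (f (hY.eigenvalues i) : ℂ)) *
        eigenCoeff hX hY Z * diagonal (fun j ↦ (g (hX.eigenvalues j) : ℂ))).trace := by
    rw [hX.cfc_eq, hY.cfc_eq, IsHermitian.cfc, IsHermitian.cfc, Unitary.conjStarAlgAut_apply,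
      Unitary.conjStarAlgAut_apply]
    simp only [eigenCoeff, conjTranspose_mul, conjTranspose_conjTranspose, ← Matrix.mul_assoc]
    rw [trace_mul_comm]
    simp only [← Matrix.mul_assoc, star_eq_conjTranspose]
    rfl
  rw [hdiag, Fintype.sum_prod_type_right, trace]
  refine Finset.sum_congr rfl fun j _ ↦ ?_
  rw [diag_apply, mul_diagonal, mul_apply, Finset.sum_mul]
  refine Finset.sum_congr rfl fun i _ ↦ ?_
  rw [mul_diagonal, conjTranspose_apply]
  push_cast
  ring

theorem trace_conjTranspose_mul_cfc_mul_cfc_self (hX : X.IsHermitian) (hY : Y.IsHermitian)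
    (f g : ℝ → ℝ) (K : Matrix m n ℂ) :
    (Kᴴ * cfc f Y * K * cfc g X).trace = (spectralForm hX hY (fun y x ↦ f y * g x) K : ℂ) := by
  simp only [trace_conjTranspose_mul_cfc_mul_cfc hX hY, spectralForm, Complex.star_def,
    Complex.conj_mul']
  push_cast
  exact Finset.sum_congr rfl fun p _ ↦ mul_comm _ _

theorem trace_conjTranspose_mul_rpow_mul_rpow (hX : X.PosDef) (hY : Y.PosDef) (s t : ℝ)
    (K : Matrix m n ℂ) :
    (Kᴴ * Y ^ s * K * X ^ t).trace =
      (spectralForm hX.1 hY.1 (fun y x ↦ y ^ s * x ^ t) K : ℂ) := by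
  rw [CFC.rpow_eq_cfc_real hX.posSemidef.nonneg, CFC.rpow_eq_cfc_real hY.posSemidef.nonneg,
    trace_conjTranspose_mul_cfc_mul_cfc_self hX.1 hY.1]

theorem re_trace_conjTranspose_mul (hX : X.IsHermitian) (hY : Y.IsHermitian)
    (K Z : Matrix m n ℂ) :
    (Kᴴ * Z).trace.re = ∑ p : m × n,
      (star (eigenCoeff hX hY K p.1 p.2) * eigenCoeff hX hY Z p.1 p.2).re := by
  have h := trace_conjTranspose_mul_cfc_mul_cfc hX hY (fun _ ↦ 1) (fun _ ↦ 1) K Z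
  rw [cfc_const_one ℝ X hX.isSelfAdjoint, cfc_const_one ℝ Y hY.isSelfAdjoint] at h
  simpa using congrArg Complex.re h

theorem spectralForm_pencil (hX : X.IsHermitian) (hY : Y.IsHermitian) (α β γ : ℝ)
    (Z : Matrix m n ℂ) :
    spectralForm hX hY (fun y x ↦ α * y + β * x + γ) Z =
      α * (Zᴴ * Y * Z).trace.re + β * (Zᴴ * Z * X).trace.re + γ * (Zᴴ * Z).trace.re := by
  have hleft := trace_conjTranspose_mul_cfc_mul_cfc_self hX hY id (fun _ ↦ 1) Z
  have hright := trace_conjTranspose_mul_cfc_mul_cfc_self hX hY (fun _ ↦ 1) id Z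
  have hone := trace_conjTranspose_mul_cfc_mul_cfc_self hX hY (fun _ ↦ 1) (fun _ ↦ 1) Z
  simp only [cfc_id ℝ Y hY.isSelfAdjoint, cfc_id ℝ X hX.isSelfAdjoint,
    cfc_const_one ℝ Y hY.isSelfAdjoint, cfc_const_one ℝ X hX.isSelfAdjoint, Matrix.mul_one]
    at hleft hright hone
  simp only [hleft, hright, hone, Complex.ofReal_re, spectralForm, Finset.mul_sum,
    ← Finset.sum_add_distrib, id]
  exact Finset.sum_congr rfl fun p _ ↦ by ring

theorem norm_sq_mul_inv_sub_eq_mul_norm_sub_sq {d : ℝ} (hd : d ≠ 0) (k z : ℂ) :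
    ‖k‖ ^ 2 * d⁻¹ - (2 * (star k * z).re - ‖z‖ ^ 2 * d) = d * ‖z - (d⁻¹ : ℝ) * k‖ ^ 2 := by
  simp only [Complex.sq_norm, Complex.normSq_apply, Complex.star_def, Complex.mul_re,
    Complex.mul_im, Complex.sub_re, Complex.sub_im, Complex.conj_re, Complex.conj_im,
    Complex.ofReal_re, Complex.ofReal_im]
  field_simp
  ring

theorem isGreatest_two_mul_re_trace_sub_spectralForm (hX : X.IsHermitian) (hY : Y.IsHermitian)
    {F : ℝ → ℝ → ℝ} (hF : ∀ i j, 0 < F (hY.eigenvalues i) (hX.eigenvalues j))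
    (K : Matrix m n ℂ) :
    IsGreatest (Set.range fun Z : Matrix m n ℂ ↦
      2 * (Kᴴ * Z).trace.re - spectralForm hX hY F Z)
      (spectralForm hX hY (fun y x ↦ (F y x)⁻¹) K) := by
  have hgap : ∀ Z, spectralForm hX hY (fun y x ↦ (F y x)⁻¹) K -
      (2 * (Kᴴ * Z).trace.re - spectralForm hX hY F Z) = ∑ p : m × n,
        F (hY.eigenvalues p.1) (hX.eigenvalues p.2) * ‖eigenCoeff hX hY Z p.1 p.2 -
          ((F (hY.eigenvalues p.1) (hX.eigenvalues p.2))⁻¹ : ℝ) *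
            eigenCoeff hX hY K p.1 p.2‖ ^ 2 := fun Z ↦ by
    simp only [← norm_sq_mul_inv_sub_eq_mul_norm_sub_sq (hF _ _).ne', Finset.sum_sub_distrib,
      ← Finset.mul_sum, ← re_trace_conjTranspose_mul, spectralForm]
  constructor
  · obtain ⟨Z, hZ⟩ := eigenCoeff_surjective hX hY (of fun i j ↦
      ((F (hY.eigenvalues i) (hX.eigenvalues j))⁻¹ : ℝ) * eigenCoeff hX hY K i j)
    refine ⟨Z, (sub_eq_zero.1 ((hgap Z).trans ?_)).symm⟩
    simp [hZ]
  · rintro _ ⟨Z, rfl⟩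
    refine sub_nonneg.1 ((hgap Z).symm ▸ Finset.sum_nonneg fun p _ ↦ ?_)
    exact mul_nonneg (hF _ _).le (sq_nonneg _)

end SpectralForm

section Comparison

open Matrix

variable {m n m' n' J : Type*} [Fintype m] [DecidableEq m] [Fintype n] [DecidableEq n]
  [Fintype m'] [DecidableEq m'] [Fintype n'] [DecidableEq n'] [Fintype J]
  {X : Matrix n n ℂ} {Y : Matrix m m ℂ} {K : Matrix m n ℂ}
  {X' : J → Matrix n' n' ℂ} {Y' : J → Matrix m' m' ℂ} {K' : J → Matrix m' n' ℂ}
  {w : J → ℝ} {T : J → Matrix m n ℂ → Matrix m' n' ℂ}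

theorem spectralForm_inv_le_sum (hX : X.IsHermitian) (hY : Y.IsHermitian)
    (hX' : ∀ j, (X' j).IsHermitian) (hY' : ∀ j, (Y' j).IsHermitian) (hw : ∀ j, 0 ≤ w j)
    {F F' : ℝ → ℝ → ℝ} (hF : ∀ i k, 0 < F (hY.eigenvalues i) (hX.eigenvalues k))
    (hF' : ∀ j i k, 0 < F' ((hY' j).eigenvalues i) ((hX' j).eigenvalues k))
    (hTK : ∀ Z, ∑ j, w j * ((K' j)ᴴ * T j Z).trace.re = (Kᴴ * Z).trace.re)
    (hTF : ∀ Z, ∑ j, w j * spectralForm (hX' j) (hY' j) F' (T j Z) ≤ spectralForm hX hY F Z) :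
    spectralForm hX hY (fun y x ↦ (F y x)⁻¹) K ≤
      ∑ j, w j * spectralForm (hX' j) (hY' j) (fun y x ↦ (F' y x)⁻¹) (K' j) := by
  obtain ⟨⟨Z, hZ⟩, -⟩ := isGreatest_two_mul_re_trace_sub_spectralForm hX hY hF K
  calc spectralForm hX hY (fun y x ↦ (F y x)⁻¹) K
      = 2 * (Kᴴ * Z).trace.re - spectralForm hX hY F Z := hZ.symm
    _ ≤ 2 * ∑ j, w j * ((K' j)ᴴ * T j Z).trace.re -
          ∑ j, w j * spectralForm (hX' j) (hY' j) F' (T j Z) := by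
        rw [hTK]
        exact sub_le_sub_left (hTF Z) _
    _ = ∑ j, w j *
          (2 * ((K' j)ᴴ * T j Z).trace.re - spectralForm (hX' j) (hY' j) F' (T j Z)) := by
        simp only [mul_sub, Finset.sum_sub_distrib, Finset.mul_sum, mul_left_comm]
    _ ≤ _ := Finset.sum_le_sum fun j _ ↦ mul_le_mul_of_nonneg_left
        ((isGreatest_two_mul_re_trace_sub_spectralForm (hX' j) (hY' j) (hF' j) (K' j)).2
          ⟨T j Z, rfl⟩) (hw j)

theorem spectralForm_rpow_le_sum_of_pencil_inv (hX : X.PosDef) (hY : Y.PosDef)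
    (hX' : ∀ j, (X' j).PosDef) (hY' : ∀ j, (Y' j).PosDef) {κ : ℝ} (hκ : 0 < κ)
    (h : ∀ α β γ : ℝ, 0 < α → 0 < β → 0 < γ →
      spectralForm hX.1 hY.1 (fun y x ↦ (α * y + β * x + γ * κ)⁻¹) K ≤
        ∑ j, w j * spectralForm (hX' j).1 (hY' j).1 (fun y x ↦ (α * y + β * x + γ)⁻¹) (K' j))
    {s t : ℝ} (hs : 0 ≤ s) (ht : 0 ≤ t) (hst : s + t ≤ 1) :
    spectralForm hX.1 hY.1 (fun y x ↦ y ^ (-s) * x ^ (-t)) K ≤ κ ^ (1 - (s + t)) *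
      ∑ j, w j * spectralForm (hX' j).1 (hY' j).1 (fun y x ↦ y ^ (-s) * x ^ (-t)) (K' j) := by
  have hmean := sum_mul_geometricMean_le_sum (ι := m × n) (ι' := J × m' × n')
    (w := fun p ↦ ‖eigenCoeff hX.1 hY.1 K p.1 p.2‖ ^ 2)
    (a := fun p ↦ hY.1.eigenvalues p.1) (b := fun p ↦ hX.1.eigenvalues p.2) (c := fun _ ↦ κ)
    (w' := fun p ↦ w p.1 * ‖eigenCoeff (hX' p.1).1 (hY' p.1).1 (K' p.1) p.2.1 p.2.2‖ ^ 2)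
    (a' := fun p ↦ (hY' p.1).1.eigenvalues p.2.1) (b' := fun p ↦ (hX' p.1).1.eigenvalues p.2.2)
    (c' := fun _ ↦ 1)
    (fun _ ↦ hY.eigenvalues_pos _) (fun _ ↦ hX.eigenvalues_pos _) (fun _ ↦ hκ)
    (fun _ ↦ (hY' _).eigenvalues_pos _) (fun _ ↦ (hX' _).eigenvalues_pos _) (fun _ ↦ one_pos)
    (fun α β γ hα hβ hγ ↦ by
      simpa only [spectralForm, Finset.mul_sum, Fintype.sum_prod_type, mul_one, mul_assoc]
        using h α β γ hα hβ hγ)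
    hs ht (sub_nonneg.2 hst) (add_sub_cancel _ _)
  have hscaled : spectralForm hX.1 hY.1 (fun y x ↦ y ^ (-s) * x ^ (-t)) K * κ ^ (-(1 - (s + t))) ≤
      ∑ j, w j * spectralForm (hX' j).1 (hY' j).1 (fun y x ↦ y ^ (-s) * x ^ (-t)) (K' j) := by
    simpa only [spectralForm, Finset.mul_sum, Finset.sum_mul, Fintype.sum_prod_type,
      Real.one_rpow, mul_one, mul_assoc] using hmean
  rwa [Real.rpow_neg hκ.le, mul_inv_le_iff₀' (Real.rpow_pos_of_pos hκ _)] at hscaled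

theorem trace_rpow_le_sum (hX : X.PosDef) (hY : Y.PosDef)
    (hX' : ∀ j, (X' j).PosDef) (hY' : ∀ j, (Y' j).PosDef) (hw : ∀ j, 0 ≤ w j)
    {κ : ℝ} (hκ : 0 < κ)
    (hTK : ∀ Z, ∑ j, w j * ((K' j)ᴴ * T j Z).trace.re = (Kᴴ * Z).trace.re)
    (hTY : ∀ Z, ∑ j, w j * ((T j Z)ᴴ * Y' j * T j Z).trace.re ≤ (Zᴴ * Y * Z).trace.re)
    (hTX : ∀ Z, ∑ j, w j * ((T j Z)ᴴ * T j Z * X' j).trace.re ≤ (Zᴴ * Z * X).trace.re)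
    (hT : ∀ Z, ∑ j, w j * ((T j Z)ᴴ * T j Z).trace.re ≤ κ * (Zᴴ * Z).trace.re)
    {s t : ℝ} (hs : 0 ≤ s) (ht : 0 ≤ t) (hst : s + t ≤ 1) :
    (Kᴴ * Y ^ (-s) * K * X ^ (-t)).trace ≤ (κ ^ (1 - (s + t)) : ℝ) *
      ∑ j, w j • ((K' j)ᴴ * (Y' j) ^ (-s) * K' j * (X' j) ^ (-t)).trace := by
  simp only [trace_conjTranspose_mul_rpow_mul_rpow hX hY,
    trace_conjTranspose_mul_rpow_mul_rpow (hX' _) (hY' _), Complex.real_smul]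
  norm_cast
  refine spectralForm_rpow_le_sum_of_pencil_inv hX hY hX' hY' hκ (fun α β γ hα hβ hγ ↦ ?_)
    hs ht hst
  refine spectralForm_inv_le_sum (T := T) hX.1 hY.1 (fun j ↦ (hX' j).1) (fun j ↦ (hY' j).1) hw
    (fun i k ↦ ?_) (fun j i k ↦ ?_) hTK fun Z ↦ ?_
  · have := hX.eigenvalues_pos k
    have := hY.eigenvalues_pos i
    positivity
  · have := (hX' j).eigenvalues_pos k
    have := (hY' j).eigenvalues_pos i
    positivity
  · calc ∑ j, w j * spectralForm (hX' j).1 (hY' j).1 (fun y x ↦ α * y + β * x + γ) (T j Z)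
        = α * ∑ j, w j * ((T j Z)ᴴ * Y' j * T j Z).trace.re +
          β * ∑ j, w j * ((T j Z)ᴴ * T j Z * X' j).trace.re +
          γ * ∑ j, w j * ((T j Z)ᴴ * T j Z).trace.re := by
          simp only [spectralForm_pencil, Finset.mul_sum, ← Finset.sum_add_distrib, mul_add,
            mul_left_comm]
      _ ≤ α * (Zᴴ * Y * Z).trace.re + β * (Zᴴ * Z * X).trace.re +
          γ * (κ * (Zᴴ * Z).trace.re) := by
          gcongr
          exacts [hTY Z, hTX Z, hT Z]
      _ = spectralForm hX.1 hY.1 (fun y x ↦ α * y + β * x + γ * κ) Z := by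
          rw [spectralForm_pencil, mul_assoc]

end Comparison

section Convexity

open Matrix

theorem convex_setOf_posDef {n 𝕜 : Type*} [RCLike 𝕜] : Convex ℝ {A : Matrix n n 𝕜 | A.PosDef} :=
  convex_iff_forall_pos.2 fun _ hA _ hB _ _ ha hb _ ↦
    Matrix.PosDef.add (hA.smul ha) (hB.smul hb)

/-- **Lieb's convexity theorem**. -/
theorem convexOn_trace_conjTranspose_mul_rpow_mul_rpow {m n : Type*} [Fintype m] [DecidableEq m]
    [Fintype n] [DecidableEq n] {s t : ℝ} (hs : 0 ≤ s) (ht : 0 ≤ t) (hst : s + t ≤ 1) :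
    ConvexOn ℝ {p : Matrix n n ℂ × Matrix m m ℂ × Matrix m n ℂ | p.1.PosDef ∧ p.2.1.PosDef}
      (fun p ↦ (p.2.2ᴴ * p.2.1 ^ (-s) * p.2.2 * p.1 ^ (-t)).trace) := by
  have hconv : Convex ℝ
      {p : Matrix n n ℂ × Matrix m m ℂ × Matrix m n ℂ | p.1.PosDef ∧ p.2.1.PosDef} :=
    fun p hp q hq a b ha hb hab ↦ ⟨convex_setOf_posDef hp.1 hq.1 ha hb hab,
      convex_setOf_posDef hp.2 hq.2 ha hb hab⟩
  refine ⟨hconv, ?_⟩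
  rintro ⟨X₁, Y₁, K₁⟩ h₁ ⟨X₂, Y₂, K₂⟩ h₂ a b ha hb hab
  obtain ⟨hX, hY⟩ := hconv h₁ h₂ ha hb hab
  have key := trace_rpow_le_sum (K := a • K₁ + b • K₂) (X' := ![X₁, X₂]) (Y' := ![Y₁, Y₂])
    (K' := ![K₁, K₂]) (w := ![a, b]) (κ := 1) (T := fun _ Z ↦ Z) hX hY
    (Fin.forall_fin_two.2 ⟨h₁.1, h₂.1⟩) (Fin.forall_fin_two.2 ⟨h₁.2, h₂.2⟩)
    (Fin.forall_fin_two.2 ⟨ha, hb⟩) one_pos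
    (by simp [Matrix.add_mul])
    (by simp [Matrix.add_mul, Matrix.mul_add])
    (by simp [Matrix.mul_add])
    (by simp [← add_mul, hab]) hs ht hst
  simpa using key

end Convexity

section SchwarzMap

open Matrix

theorem trace_mul_nonneg_of_posSemidef {n 𝕜 : Type*} [Fintype n] [RCLike 𝕜] {A B : Matrix n n 𝕜}
    (hA : A.PosSemidef) (hB : B.PosSemidef) : 0 ≤ (A * B).trace := by
  classical
  obtain ⟨Q, rfl⟩ := CStarAlgebra.nonneg_iff_eq_star_mul_self.1 hB.nonneg
  rw [← mul_assoc, trace_mul_comm, ← mul_assoc]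
  exact (hA.mul_mul_conjTranspose_same Q).trace_nonneg

namespace IsSchwarzMap

variable {m n : ℕ} {Φ : Matrix (Fin m) (Fin m) ℂ →ₗ[ℂ] Matrix (Fin n) (Fin n) ℂ}

theorem map_nonneg (hΦ : IsSchwarzMap Φ) (A : Matrix (Fin m) (Fin m) ℂ) (hA : 0 ≤ A) :
    0 ≤ Φ A := by
  obtain ⟨K, rfl⟩ := CStarAlgebra.nonneg_iff_eq_star_mul_self.1 hA
  exact (star_mul_self_nonneg (Φ K)).trans (hΦ K)

theorem map_conjTranspose (hΦ : IsSchwarzMap Φ) (K : Matrix (Fin m) (Fin m) ℂ) :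
    Φ Kᴴ = (Φ K)ᴴ :=
  map_star (PositiveLinearMap.mk₀ Φ hΦ.map_nonneg) K

theorem trace_map_mul (hΦ : IsSchwarzMap Φ) (B : Matrix (Fin m) (Fin m) ℂ)
    (A : Matrix (Fin n) (Fin n) ℂ) : (Φ B * A).trace = (B * hsAdjoint Φ A).trace := by
  simpa only [hΦ.map_conjTranspose, conjTranspose_conjTranspose] using
    trace_conjTranspose_mul_hsAdjoint Φ Bᴴ A

theorem hsAdjoint_conjTranspose (hΦ : IsSchwarzMap Φ) (A : Matrix (Fin n) (Fin n) ℂ) :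
    hsAdjoint Φ Aᴴ = (hsAdjoint Φ A)ᴴ := by
  ext i j
  change ((Φ (single i j 1))ᴴ * Aᴴ).trace = star ((Φ (single j i 1))ᴴ * A).trace
  rw [← trace_conjTranspose, conjTranspose_mul, conjTranspose_conjTranspose,
    ← hΦ.map_conjTranspose, conjTranspose_single, star_one, trace_mul_comm]

theorem hsAdjoint_posSemidef (hΦ : IsSchwarzMap Φ) {A : Matrix (Fin n) (Fin n) ℂ}
    (hA : A.PosSemidef) : (hsAdjoint Φ A).PosSemidef := by
  refine .of_dotProduct_mulVec_nonneg ?_ fun v ↦ ?_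
  · rw [IsHermitian, ← hΦ.hsAdjoint_conjTranspose, hA.1]
  · have htrace : star v ⬝ᵥ hsAdjoint Φ A *ᵥ v = (Φ (vecMulVec v (star v)) * A).trace := by
      rw [hΦ.trace_map_mul, vecMulVec_mul, trace_vecMulVec, dotProduct_mulVec, dotProduct_comm]
    rw [htrace]
    exact trace_mul_nonneg_of_posSemidef
      (hΦ.map_nonneg _ (posSemidef_vecMulVec_self_star v).nonneg).posSemidef hA

theorem hsAdjoint_posDef (hΦ : IsSchwarzMap Φ) (hone : (hsAdjoint Φ 1).PosDef)
    {X : Matrix (Fin n) (Fin n) ℂ} (hX : X.PosDef) : (hsAdjoint Φ X).PosDef := by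
  cases isEmpty_or_nonempty (Fin n)
  · rwa [Subsingleton.elim X 1]
  obtain ⟨ε, hε, hεX⟩ : ∃ ε > 0, algebraMap ℝ (Matrix (Fin n) (Fin n) ℂ) ε ≤ X :=
    (CFC.exists_pos_algebraMap_le_iff hX.1).2 fun _ ↦ hX.isStrictlyPositive.spectrum_pos
  have hrest := hΦ.hsAdjoint_posSemidef (sub_nonneg.2 hεX).posSemidef
  have hsplit : hsAdjoint Φ X =
      ε • hsAdjoint Φ 1 + hsAdjoint Φ (X - algebraMap ℝ _ ε) := by
    rw [Algebra.algebraMap_eq_smul_one, map_sub, LinearMap.map_smul_of_tower,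
      add_sub_cancel]
  exact hsplit ▸ (hone.smul hε).add_posSemidef hrest

theorem trace_conjTranspose_map_mul_map_mul_le (hΦ : IsSchwarzMap Φ)
    {X : Matrix (Fin n) (Fin n) ℂ} (hX : X.PosSemidef) (Z : Matrix (Fin m) (Fin m) ℂ) :
    ((Φ Z)ᴴ * Φ Z * X).trace ≤ (Zᴴ * Z * hsAdjoint Φ X).trace := by
  rw [← hΦ.trace_map_mul, ← sub_nonneg, ← trace_sub, ← sub_mul]
  exact trace_mul_nonneg_of_posSemidef (hΦ Z) hX

theorem trace_conjTranspose_map_mul_mul_map_le (hΦ : IsSchwarzMap Φ)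
    {Y : Matrix (Fin n) (Fin n) ℂ} (hY : Y.PosSemidef) (Z : Matrix (Fin m) (Fin m) ℂ) :
    ((Φ Z)ᴴ * Y * Φ Z).trace ≤ (Zᴴ * hsAdjoint Φ Y * Z).trace := by
  have h := hΦ.trace_conjTranspose_map_mul_map_mul_le hY Zᴴ
  rwa [hΦ.map_conjTranspose, conjTranspose_conjTranspose, conjTranspose_conjTranspose,
    ← trace_mul_cycle, ← trace_mul_cycle Zᴴ] at h

theorem trace_hsAdjoint_rpow_le (hΦ : IsSchwarzMap Φ) (hone : (hsAdjoint Φ 1).PosDef)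
    {κ : ℝ} (hκ : 0 < κ) (hΦκ : hsAdjoint Φ 1 ≤ κ • 1)
    {X Y : Matrix (Fin n) (Fin n) ℂ} (hX : X.PosDef) (hY : Y.PosDef)
    (K : Matrix (Fin n) (Fin n) ℂ) {s t : ℝ} (hs : 0 ≤ s) (ht : 0 ≤ t) (hst : s + t ≤ 1) :
    (hsAdjoint Φ Kᴴ * hsAdjoint Φ Y ^ (-s) * hsAdjoint Φ K * hsAdjoint Φ X ^ (-t)).trace ≤
      (κ ^ (1 - (s + t)) : ℝ) * (Kᴴ * Y ^ (-s) * K * X ^ (-t)).trace := by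
  have hK (Z) : (Kᴴ * Φ Z).trace = ((hsAdjoint Φ K)ᴴ * Z).trace := by
    rw [trace_mul_comm, hΦ.trace_map_mul, hΦ.hsAdjoint_conjTranspose, trace_mul_comm]
  have hκZ (Z) : ((Φ Z)ᴴ * Φ Z).trace ≤ κ * (Zᴴ * Z).trace := by
    have hgap := trace_mul_nonneg_of_posSemidef (posSemidef_conjTranspose_mul_self Z) hΦκ
    have hle := hΦ.trace_conjTranspose_map_mul_map_mul_le .one Z
    rw [mul_sub, trace_sub, sub_nonneg] at hgap
    simpa using hle.trans hgap
  rw [hΦ.hsAdjoint_conjTranspose]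
  simpa using trace_rpow_le_sum (J := Unit) (K := hsAdjoint Φ K) (K' := fun _ ↦ K)
    (w := fun _ ↦ 1) (T := fun _ ↦ Φ)
    (hΦ.hsAdjoint_posDef hone hX) (hΦ.hsAdjoint_posDef hone hY) (fun _ ↦ hX) (fun _ ↦ hY)
    (fun _ ↦ zero_le_one) hκ (by simp [hK])
    (fun Z ↦ by simpa using (hΦ.trace_conjTranspose_map_mul_mul_map_le hY.posSemidef Z).1)
    (fun Z ↦ by simpa using (hΦ.trace_conjTranspose_map_mul_map_mul_le hX.posSemidef Z).1)
    (fun Z ↦ by simpa using (hκZ Z).1) hs ht hst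

end IsSchwarzMap

end SchwarzMap

theorem IsSemiunital.hsAdjoint_one_le {m n : ℕ}
    {Φ : Matrix (Fin m) (Fin m) ℂ →ₗ[ℂ] Matrix (Fin n) (Fin n) ℂ} (hΦ : IsSemiunital Φ) :
    hsAdjoint Φ 1 ≤ ((n : ℝ) / m) • (1 : Matrix (Fin m) (Fin m) ℂ) := by
  refine (hΦ.trans ?_).le
  rw [← Complex.coe_smul]
  push_cast
  rfl

open Matrix in
theorem theorem4p3_general {s t : ℝ} (hs : 0 ≤ s) (ht : 0 ≤ t) (hst : s + t ≤ 1) :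
    (∀ {m n : ℕ} {Φ : Matrix (Fin m) (Fin m) ℂ →ₗ[ℂ] Matrix (Fin n) (Fin n) ℂ} {κ : ℝ},
      IsSchwarzMap Φ → (hsAdjoint Φ 1).PosDef → 0 < κ → hsAdjoint Φ 1 ≤ κ • 1 →
      ∀ {X Y : Matrix (Fin n) (Fin n) ℂ}, X.PosDef → Y.PosDef → ∀ K : Matrix (Fin n) (Fin n) ℂ,
        (hsAdjoint Φ Kᴴ * hsAdjoint Φ Y ^ (-s) * hsAdjoint Φ K * hsAdjoint Φ X ^ (-t)).trace ≤
          (κ ^ (1 - (s + t)) : ℝ) * (Kᴴ * Y ^ (-s) * K * X ^ (-t)).trace) ∧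
    (∀ (m n : Type*) [Fintype m] [DecidableEq m] [Fintype n] [DecidableEq n],
      ConvexOn ℝ {p : Matrix n n ℂ × Matrix m m ℂ × Matrix m n ℂ | p.1.PosDef ∧ p.2.1.PosDef}
        (fun p ↦ (p.2.2ᴴ * p.2.1 ^ (-s) * p.2.2 * p.1 ^ (-t)).trace)) :=
  ⟨fun hΦ hone hκ hΦκ _ _ hX hY K ↦ hΦ.trace_hsAdjoint_rpow_le hone hκ hΦκ hX hY K hs ht hst,
    fun _ _ _ _ _ _ ↦ convexOn_trace_conjTranspose_mul_rpow_mul_rpow hs ht hst⟩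

/-- Inequalities between traces are in the partial order of `ℂ`, where `z ≤ w` means
`z.re ≤ w.re` and `z.im = w.im`.  Real powers of matrices are those of the continuous functional
calculus. -/
theorem theorem4p3 :
    (∀ (s t : ℝ), 0 < s → 0 < t → s + t ≤ 1 → ∀ (m n : ℕ), 0 < m → 0 < n →
      ∀ (X Y K : Matrix (Fin n) (Fin n) ℂ), X.PosDef → Y.PosDef →
      ∀ (Φ : Matrix (Fin m) (Fin m) ℂ →ₗ[ℂ] Matrix (Fin n) (Fin n) ℂ),
        IsSchwarzMap Φ → IsSemiunital Φ → (hsAdjoint Φ 1).PosDef →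
        (hsAdjoint Φ K.conjTranspose * (hsAdjoint Φ Y) ^ (-s) *
            hsAdjoint Φ K * (hsAdjoint Φ X) ^ (-t)).trace ≤
          ((((n : ℝ) / (m : ℝ)) ^ (1 - (s + t)) : ℝ) : ℂ) *
            (K.conjTranspose * Y ^ (-s) * K * X ^ (-t)).trace) ∧
    (∀ (s t : ℝ), 0 ≤ s → 0 ≤ t → s + t ≤ 1 → ∀ (n : ℕ), 0 < n →
      ConvexOn ℝ
        {p : Matrix (Fin n) (Fin n) ℂ × Matrix (Fin n) (Fin n) ℂ × Matrix (Fin n) (Fin n) ℂ |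
          p.1.PosDef ∧ p.2.1.PosDef}
        (fun p => (p.2.2.conjTranspose * p.2.1 ^ (-s) * p.2.2 * p.1 ^ (-t)).trace)) :=
  ⟨fun _ _ hs ht hst _ _ hm hn _ _ K hX hY _ hΦ hunital hone ↦
      (theorem4p3_general.{0, 0} hs.le ht.le hst).1 hΦ hone (by positivity)
        hunital.hsAdjoint_one_le hX hY K,
    fun _ _ hs ht hst _ _ ↦ (theorem4p3_general.{0, 0} hs ht hst).2 _ _⟩
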